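/- Let $\Omega$ be a finite or countably infinite set, let $A\subseteq\Omega$ be a set of interesting items, let $P$ be a probability distribution on $\Omega$, let $n\ge 1$ be an integer, and let $X_1,\dots,X_n$ be independent random variables with common distribution $P$. For $x\in\Omega$ let $O_n(x)=\sum_{m=1}^n \mathbf 1\{X_m=x\}$ be the number of occurrences of $x$ in the sample. Let \[ R_n=\sum_{x\in A}\mathbf 1\{O_n(x)=0\}\,P(\{x\}) \] be the missing mass of the interesting items, and let \[ \hat R_n=\frac1n\sum_{x\in A}\mathbf 1\{O_n(x)=1\} \] be the Good--Turing estimator (the number of elements of $A$ seen exactly once, divided by $n$). Then, for every $\delta>0$, with probability at least $1-\delta$, \[ \hat R_n-\frac1n-(1+\sqrt2)\sqrt{\frac{\log(4/\delta)}{n}}\;\le\; R_n\;\le\;\hat R_n+(1+\sqrt2)\sqrt{\frac{\log(4/\delta)}{n}} , \] where both inequalities hold simultaneously on the same event. (For $\delta\ge 1$ the claim is empty, and the square root of a negative number is read as $0$.) The bound holds whatever the distribution $P$ and the set $A$. -/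

import Mathlib

open MeasureTheory ProbabilityTheory

noncomputable section

namespace GoodTuring

variable {Ω : Type*} {n : ℕ}

open Classical in
/-- `O_n(ω)`: the number of indices `m` at which the sample `x = (x_1, …, x_n)` takes the
value `ω`. -/
def occ (x : Fin n → Ω) (ω : Ω) : ℕ := ∑ m : Fin n, if x m = ω then 1 else 0

/-- `Z_n(ω)`: the indicator that `ω` does not occur in the sample. -/
def unseen (x : Fin n → Ω) (ω : Ω) : ℝ := if occ x ω = 0 then 1 else 0

/-- `U_n(ω)`: the indicator that `ω` occurs exactly once in the sample. -/
def seenOnce (x : Fin n → Ω) (ω : Ω) : ℝ := if occ x ω = 1 then 1 else 0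

/-- The missing mass of the interesting items, `R_n = ∑_{ω ∈ A} Z_n(ω) P(ω)`. -/
def missingMass [MeasurableSpace Ω] (P : Measure Ω) (A : Set Ω) (x : Fin n → Ω) : ℝ :=
  ∑' ω : A, unseen x (ω : Ω) * P.real {(ω : Ω)}

/-- The number of interesting items seen exactly once (hapaxes), `U_n = ∑_{ω ∈ A} U_n(ω)`. -/
def hapaxCount (A : Set Ω) (x : Fin n → Ω) : ℝ := ∑' ω : A, seenOnce x (ω : Ω)

/-- The Good-Turing estimator `U_n / n`. -/
def estimator (A : Set Ω) (x : Fin n → Ω) : ℝ := hapaxCount A x / n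

end GoodTuring

end

namespace GoodTuring

/-! The means of the estimator and of the missing mass differ by between `0` and `1 / n`
(`integral_estimator_bias`), so it is enough that each concentrates about its mean. One sample point
moves the estimator by at most `2 / n`, and McDiarmid's inequality gives variance proxy `1 / n`. The
missing mass is a sum of dependent terms `w * Z`, with `Z` Bernoulli of parameter `(1 - w) ^ n`. The
`Z` are negatively dependent, so its moment generating function is at most the product of the
individual ones (`integral_exp_sum_unseen_le_prod`). Hoeffding's lemma would cost `t ^ 2 * w ^ 2 /
8` per item, with no decay in `n`; the Kearns-Saul bound costs `t ^ 2 * w / (4 * n)`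
(`unseen_factor_le`). The `w` sum to at most `1`, so the proxy is `1 / (2 * n)`. With `r = √(log (4
/ δ) / n)`, deviations `r` and `√2 * r` each have probability at most `δ / 2`, and a union bound
concludes. -/

/-! ### Kearns-Saul bound for Bernoulli variables -/

lemma hasDerivAt_tanh (x : ℝ) : HasDerivAt Real.tanh (1 / Real.cosh x ^ 2) x := by
  have h := (Real.hasDerivAt_sinh x).div (Real.hasDerivAt_cosh x) (Real.cosh_pos x).ne'
  have he : (Real.sinh / Real.cosh : ℝ → ℝ) = Real.tanh := by
    funext y; simp [Real.tanh_eq_sinh_div_cosh]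
  rw [he] at h
  have e : 1 = Real.cosh x * Real.cosh x - Real.sinh x * Real.sinh x := by
    linear_combination -Real.cosh_sq x
  rwa [← e] at h

lemma concaveOn_tanh : ConcaveOn ℝ (Set.Ici (0 : ℝ)) Real.tanh := by
  refine AntitoneOn.concaveOn_of_deriv (convex_Ici 0)
    (fun x _ => (hasDerivAt_tanh x).continuousAt.continuousWithinAt)
    (fun x _ => (hasDerivAt_tanh x).differentiableAt.differentiableWithinAt) ?_
  intro x hx y hy hxy
  rw [interior_Ici] at hx hy
  rw [(hasDerivAt_tanh x).deriv, (hasDerivAt_tanh y).deriv]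
  have h1 : Real.cosh x ≤ Real.cosh y := by
    rw [Real.cosh_le_cosh, abs_of_pos hx, abs_of_pos hy]; exact hxy
  have := Real.cosh_pos x
  gcongr

/-- Concavity and `tanh 0 = 0` make `tanh y / y` decreasing. -/
lemma mul_tanh_le_mul_tanh {x y : ℝ} (hx : 0 ≤ x) (hy : 0 < y) (hxy : x ≤ y) :
    x * Real.tanh y ≤ y * Real.tanh x := by
  have h := concaveOn_tanh.2 (Set.mem_Ici.2 le_rfl) (Set.mem_Ici.2 hy.le)
    (show 0 ≤ 1 - x / y by rw [sub_nonneg, div_le_one hy]; exact hxy)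
    (show 0 ≤ x / y by positivity) (by ring)
  simp only [smul_eq_mul, Real.tanh_zero, mul_zero, zero_add] at h
  rw [div_mul_cancel₀ _ hy.ne', div_mul_eq_mul_div, div_le_iff₀ hy] at h
  linarith

/-- Right side minus left side has derivative `y * (tanh c / c - tanh y / y)`, which changes sign
from negative to positive at `c`, where the two sides agree. -/
lemma log_cosh_le_of_nonneg {c x : ℝ} (hc : 0 < c) (hx : 0 ≤ x) :
    Real.log (Real.cosh x)
      ≤ Real.log (Real.cosh c) + Real.tanh c / (2 * c) * (x ^ 2 - c ^ 2) := by
  set h : ℝ → ℝ := fun y => Real.tanh c / (2 * c) * y ^ 2 - Real.log (Real.cosh y) with hh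
  have hd : ∀ y, HasDerivAt h (Real.tanh c / c * y - Real.tanh y) y := by
    intro y
    have h1 := ((hasDerivAt_pow 2 y).const_mul (Real.tanh c / (2 * c))).sub
      ((Real.hasDerivAt_cosh y).log (Real.cosh_pos y).ne')
    refine h1.congr_deriv ?_
    rw [Real.tanh_eq_sinh_div_cosh y]
    field_simp
    push_cast
    ring
  have hcont : Continuous h := continuous_iff_continuousAt.2 fun y => (hd y).continuousAt
  suffices h c ≤ h x by simp only [hh] at this; linarith
  rcases le_total x c with hxc | hxc
  · refine antitoneOn_of_deriv_nonpos (convex_Icc 0 c) hcont.continuousOn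
      (fun y _ => (hd y).differentiableAt.differentiableWithinAt) ?_ ⟨hx, hxc⟩ ⟨hc.le, le_rfl⟩ hxc
    intro y hy
    rw [interior_Icc] at hy
    rw [(hd y).deriv, div_mul_eq_mul_div, sub_nonpos, div_le_iff₀ hc]
    linarith [mul_tanh_le_mul_tanh hy.1.le hc hy.2.le]
  · refine monotoneOn_of_deriv_nonneg (convex_Ici c) hcont.continuousOn
      (fun y _ => (hd y).differentiableAt.differentiableWithinAt) ?_ (Set.mem_Ici.2 le_rfl) hxc hxc
    intro y hy
    rw [interior_Ici] at hy
    rw [(hd y).deriv, div_mul_eq_mul_div, sub_nonneg, le_div_iff₀ hc]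
    linarith [mul_tanh_le_mul_tanh hc.le (hc.trans hy) (le_of_lt hy)]

/-- The tangent bound for `log cosh` as a (concave) function of the square of its argument. -/
lemma log_cosh_le {c : ℝ} (hc : c ≠ 0) (x : ℝ) :
    Real.log (Real.cosh x)
      ≤ Real.log (Real.cosh c) + Real.tanh c / (2 * c) * (x ^ 2 - c ^ 2) := by
  have h := log_cosh_le_of_nonneg (abs_pos.2 hc) (abs_nonneg x)
  rw [Real.cosh_abs, Real.cosh_abs, sq_abs, sq_abs] at h
  rcases abs_cases c with ⟨h1, _⟩ | ⟨h1, _⟩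
  · rwa [h1] at h
  · rw [h1, Real.tanh_neg, mul_neg, neg_div_neg_eq] at h
    exact h

/-- The comparison of `-log (1 - q)` with `-2 q log q`, on either side of `q = 1 / 2`. -/
lemma two_mul_negMulLog_add_log_one_sub {q : ℝ} (h0 : 0 < q) (h1 : q < 1) :
    (q ≤ 1 / 2 → 0 ≤ 2 * Real.negMulLog q + Real.log (1 - q)) ∧
      (1 / 2 ≤ q → 2 * Real.negMulLog q + Real.log (1 - q) ≤ 0) := by
  -- `k` is concave and vanishes at `0` and `1 / 2`: nonnegative between these zeros, nonpositive
  -- beyond.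
  set k : ℝ → ℝ := fun q => 2 * Real.negMulLog q + Real.log (1 - q) with hk
  have hconc : ConcaveOn ℝ (Set.Ico (0 : ℝ) 1) k := by
    refine ConcaveOn.add (f := fun q => 2 * Real.negMulLog q) (g := fun q => Real.log (1 - q)) ?_ ?_
    · exact (Real.concaveOn_negMulLog.subset (fun x hx => hx.1) (convex_Ico 0 1)).smul
        (by norm_num : (0 : ℝ) ≤ 2)
    · refine ⟨convex_Ico 0 1, fun x hx y hy a b ha hb hab => ?_⟩
      have := strictConcaveOn_log_Ioi.concaveOn.2 (x := 1 - x) (y := 1 - y)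
        (Set.mem_Ioi.2 (by linarith [hx.2])) (Set.mem_Ioi.2 (by linarith [hy.2])) ha hb hab
      refine this.trans_eq ?_
      congr 1
      simp only [smul_eq_mul]
      linear_combination hab
  have k0 : k 0 = 0 := by simp [hk]
  have k1 : k (1 / 2) = 0 := by
    simp only [hk, Real.negMulLog]
    rw [show (1 : ℝ) - 1 / 2 = 1 / 2 by norm_num]
    ring
  constructor
  · intro hq
    have := hconc.2 (show (0 : ℝ) ∈ Set.Ico 0 1 from ⟨le_rfl, one_pos⟩)
      (show (1 / 2 : ℝ) ∈ Set.Ico 0 1 from ⟨by norm_num, by norm_num⟩)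
      (show 0 ≤ 1 - 2 * q by linarith) (show 0 ≤ 2 * q by linarith) (by ring)
    rw [k0, k1] at this
    simp only [smul_eq_mul, mul_zero, add_zero, zero_add] at this
    rwa [show 2 * q * (1 / 2) = q by ring] at this
  · intro hq
    have := hconc.2 (show (0 : ℝ) ∈ Set.Ico 0 1 from ⟨le_rfl, one_pos⟩)
      (show q ∈ Set.Ico 0 1 from ⟨h0.le, h1⟩)
      (show 0 ≤ 1 - 1 / (2 * q) by
        rw [sub_nonneg, div_le_one (by positivity)]; linarith)
      (show 0 ≤ 1 / (2 * q) by positivity) (by ring)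
    rw [k0] at this
    simp only [smul_eq_mul, mul_zero, zero_add] at this
    rw [show 1 / (2 * q) * q = 1 / 2 by field_simp, k1] at this
    by_contra hcon
    push Not at hcon
    have : 0 < 1 / (2 * q) * k q := mul_pos (by positivity) hcon
    linarith

/-- A **Kearns-Saul** type bound on the moment generating function of a Bernoulli variable. -/
lemma bernoulli_mgf_le {q : ℝ} (h0 : 0 < q) (h1 : q < 1) (s : ℝ) :
    1 + (Real.exp s - 1) * q ≤ Real.exp (s * q + s ^ 2 / (4 * -Real.log q)) := by
  have hL : 0 < -Real.log q := neg_pos.2 (Real.log_neg h0 h1)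
  set L := -Real.log q with hLdef
  have h1q : 0 < 1 - q := by linarith
  -- `c` is the log-odds of failure; recentring at `c / 2` turns the Bernoulli moment generating
  -- function into a ratio of `cosh` values.
  set c := Real.log (1 - q) + L with hc
  have hec : Real.exp c = (1 - q) / q := by
    rw [hc, hLdef, ← sub_eq_add_neg, Real.exp_sub, Real.exp_log h1q, Real.exp_log h0]
  have hec' : Real.exp (c / 2) ^ 2 = (1 - q) / q := by
    rw [← hec, ← Real.exp_nat_mul]; congr 1; push_cast; ring
  have hratio : 1 + (Real.exp s - 1) * q
      = Real.exp (s / 2) * Real.cosh ((s - c) / 2) / Real.cosh (c / 2) := by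
    have hs : Real.exp s = Real.exp (s / 2) ^ 2 := by
      rw [← Real.exp_nat_mul]; congr 1; push_cast; ring
    rw [eq_div_iff (Real.cosh_pos _).ne', Real.cosh_eq, Real.cosh_eq,
      show (s - c) / 2 = s / 2 - c / 2 by ring, neg_sub, Real.exp_sub, Real.exp_sub, Real.exp_neg, hs]
    have e1 := Real.exp_pos (s / 2)
    have e2 := Real.exp_pos (c / 2)
    set u := Real.exp (s / 2)
    set v := Real.exp (c / 2)
    rw [eq_div_iff h0.ne'] at hec'
    field_simp
    linear_combination (u ^ 2 - 1) * hec'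
  -- At `q = 1 / 2` the tangent slope below would read `0 / 0`.
  by_cases hcz : c = 0
  · have hq : q = 1 / 2 := by
      rw [hcz, Real.exp_zero, eq_div_iff h0.ne'] at hec; linarith
    rw [hratio, hcz]
    have hL2 : L ≤ 2 := by
      rw [hLdef, hq, one_div, Real.log_inv, neg_neg]
      linarith [Real.log_two_lt_d9]
    simp only [zero_div, Real.cosh_zero, div_one, sub_zero]
    calc Real.exp (s / 2) * Real.cosh (s / 2)
        ≤ Real.exp (s / 2) * Real.exp ((s / 2) ^ 2 / 2) := by
          gcongr; exact Real.cosh_le_exp_half_sq _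
      _ = Real.exp (s / 2 + s ^ 2 / 8) := by rw [← Real.exp_add]; congr 1; ring
      _ ≤ _ := by
          rw [Real.exp_le_exp, hq]
          have : s ^ 2 / 8 ≤ s ^ 2 / (4 * L) := by
            gcongr; linarith
          linarith
  · have hc2 : c / 2 ≠ 0 := by simpa using hcz
    have htanh : Real.tanh (c / 2) = 1 - 2 * q := by
      rw [Real.tanh_eq_sinh_div_cosh, div_eq_iff (Real.cosh_pos _).ne', Real.sinh_eq, Real.cosh_eq,
        Real.exp_neg]
      have e2 := Real.exp_pos (c / 2)
      set v := Real.exp (c / 2)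
      rw [eq_div_iff h0.ne'] at hec'
      field_simp
      linear_combination 2 * hec'
    -- This replaces the Kearns-Saul constant by one involving only `log q`. Cleared of denominators
    -- it compares `-log (1 - q)` with `-2 q log q`; the sign of `c` flips the comparison at `1 /
    -- 2`.
    have hslope : (1 - 2 * q) / c ≤ 1 / L := by
      obtain ⟨hk1, hk2⟩ := two_mul_negMulLog_add_log_one_sub h0 h1
      have hn : Real.negMulLog q = q * L := by rw [Real.negMulLog, hLdef]; ring
      rw [hn] at hk1 hk2
      rcases lt_or_gt_of_ne hcz with hneg | hpos
      · have hq : 1 / 2 ≤ q := by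
          have : Real.exp c < 1 := Real.exp_lt_one_iff.2 hneg
          rw [hec, div_lt_one h0] at this
          linarith
        rw [div_le_iff_of_neg hneg, div_mul_eq_mul_div, one_mul, div_le_iff₀ hL]
        nlinarith [hk2 hq]
      · have hq : q ≤ 1 / 2 := by
          have : 1 < Real.exp c := Real.one_lt_exp_iff.2 hpos
          rw [hec, one_lt_div h0] at this
          linarith
        rw [div_le_div_iff₀ hpos hL]
        nlinarith [hk1 hq]
    have hlc := log_cosh_le hc2 ((s - c) / 2)
    have hcosh : Real.cosh ((s - c) / 2) ≤ Real.cosh (c / 2)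
        * Real.exp ((1 - 2 * q) / c * (((s - c) / 2) ^ 2 - (c / 2) ^ 2)) := by
      rw [← Real.log_le_log_iff (Real.cosh_pos _) (mul_pos (Real.cosh_pos _) (Real.exp_pos _)),
        Real.log_mul (Real.cosh_pos _).ne' (Real.exp_pos _).ne', Real.log_exp]
      rw [htanh, mul_div_cancel₀ _ (two_ne_zero)] at hlc
      exact hlc
    rw [hratio, div_le_iff₀ (Real.cosh_pos _)]
    calc Real.exp (s / 2) * Real.cosh ((s - c) / 2)
        ≤ Real.exp (s / 2) * (Real.cosh (c / 2)
          * Real.exp ((1 - 2 * q) / c * (((s - c) / 2) ^ 2 - (c / 2) ^ 2))) := by gcongr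
      _ = Real.exp (s / 2 + (1 - 2 * q) / c * (((s - c) / 2) ^ 2 - (c / 2) ^ 2))
          * Real.cosh (c / 2) := by rw [Real.exp_add]; ring
      _ ≤ _ := by
          gcongr ?_ * _
          rw [Real.exp_le_exp]
          have e : s / 2 + (1 - 2 * q) / c * (((s - c) / 2) ^ 2 - (c / 2) ^ 2)
              = s * q + s ^ 2 / 4 * ((1 - 2 * q) / c) := by field_simp; ring
          have e' : s ^ 2 / (4 * L) = s ^ 2 / 4 * (1 / L) := by field_simp
          rw [e, e']
          gcongr

/-- The moment generating function bound for one unseen item of probability `w`. -/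
lemma unseen_factor_le {w : ℝ} (h0 : 0 ≤ w) (h1 : w ≤ 1) {n : ℕ} (hn : 1 ≤ n) (t : ℝ) :
    1 + (Real.exp (t * w) - 1) * (1 - w) ^ n
      ≤ Real.exp (t * (w * (1 - w) ^ n) + t ^ 2 / (4 * n) * w) := by
  have hn' : (0 : ℝ) < n := by exact_mod_cast hn
  rcases h0.eq_or_lt with rfl | h0
  · simp
  rcases h1.eq_or_lt with rfl | h1
  · rw [sub_self, zero_pow (by omega)]
    simp only [mul_zero, add_zero, zero_add, mul_one]
    exact Real.one_le_exp (by positivity)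
  have h1w : 0 < 1 - w := by linarith
  refine (bernoulli_mgf_le (pow_pos h1w n) (pow_lt_one₀ h1w.le (by linarith) (by omega))
    (t * w)).trans ?_
  rw [Real.exp_le_exp, mul_assoc]
  gcongr
  -- The gain in `n`: rarity of the event divides `w ^ 2` by `n * w`, leaving `w / n`, which is
  -- summable over items.
  have hlog : n * w ≤ -Real.log ((1 - w) ^ n) := by
    rw [Real.log_pow]
    have := Real.log_le_sub_one_of_pos h1w
    nlinarith
  calc (t * w) ^ 2 / (4 * -Real.log ((1 - w) ^ n)) ≤ (t * w) ^ 2 / (4 * (n * w)) := by gcongr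
    _ = t ^ 2 / (4 * n) * w := by field_simp

/-! ### Bounded functions -/

section Bounded

variable {α : Type*}

/-- A real function with bounded absolute value. -/
def Bdd (f : α → ℝ) : Prop := ∃ C, ∀ x, |f x| ≤ C

lemma Bdd.comp {β : Type*} {f : α → ℝ} (hf : Bdd f) (g : β → α) : Bdd (fun x => f (g x)) :=
  hf.imp fun _ h x => h (g x)

lemma Bdd.neg {f : α → ℝ} (hf : Bdd f) : Bdd (fun x => -f x) := by
  obtain ⟨C, h⟩ := hf
  exact ⟨C, fun x => by rw [abs_neg]; exact h x⟩

lemma Bdd.mul {f g : α → ℝ} (hf : Bdd f) (hg : Bdd g) : Bdd (fun x => f x * g x) := by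
  obtain ⟨C, h⟩ := hf
  obtain ⟨D, h'⟩ := hg
  exact ⟨C * D, fun x => by
    rw [abs_mul]; exact mul_le_mul (h x) (h' x) (abs_nonneg _) ((abs_nonneg _).trans (h x))⟩

lemma Bdd.add {f g : α → ℝ} (hf : Bdd f) (hg : Bdd g) : Bdd (fun x => f x + g x) := by
  obtain ⟨C, h⟩ := hf
  obtain ⟨D, h'⟩ := hg
  exact ⟨C + D, fun x => (abs_add_le _ _).trans (add_le_add (h x) (h' x))⟩

lemma bdd_const (c : ℝ) : Bdd (fun _ : α => c) := ⟨|c|, fun _ => le_rfl⟩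

lemma Bdd.sub {f g : α → ℝ} (hf : Bdd f) (hg : Bdd g) : Bdd (fun x => f x - g x) := by
  simpa only [sub_eq_add_neg] using hf.add hg.neg

lemma Bdd.exp {f : α → ℝ} (hf : Bdd f) : Bdd (fun x => Real.exp (f x)) := by
  obtain ⟨C, h⟩ := hf
  exact ⟨Real.exp C, fun x => by
    rw [Real.abs_exp, Real.exp_le_exp]; exact (le_abs_self _).trans (h x)⟩

lemma Bdd.sum {ι : Type*} {f : ι → α → ℝ} (F : Finset ι) (hf : ∀ i ∈ F, Bdd (f i)) :
    Bdd (fun x => ∑ i ∈ F, f i x) := by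
  classical
  induction F using Finset.induction_on with
  | empty => simpa using bdd_const 0
  | insert a F ha ih =>
    simp only [Finset.sum_insert ha]
    exact (hf a (Finset.mem_insert_self _ _)).add
      (ih fun i hi => hf i (Finset.mem_insert_of_mem hi))

variable [MeasurableSpace α]

lemma Bdd.integrable [DiscreteMeasurableSpace α] {f : α → ℝ} (hf : Bdd f) (P : Measure α) [IsFiniteMeasure P] :
    Integrable f P := by
  obtain ⟨C, h⟩ := hf
  exact Integrable.of_bound (Measurable.of_discrete (f := f)).aestronglyMeasurable C
    (ae_of_all _ h)

lemma Bdd.integral {β : Type*} {f : β → α → ℝ} (hf : ∃ C, ∀ x y, |f x y| ≤ C) (P : Measure α)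
    [IsProbabilityMeasure P] : Bdd (fun x => ∫ y, f x y ∂P) := by
  obtain ⟨C, h⟩ := hf
  refine ⟨C, fun x => ?_⟩
  simpa using norm_integral_le_of_norm_le_const (μ := P) (f := f x) (ae_of_all _ (h x))

end Bounded

/-! ### Product measures: McDiarmid's inequality and avoiding a point -/

section Product

open Classical in
/-- The indicator that a point differs from `a`. -/
noncomputable def neInd {Ω : Type*} (a x : Ω) : ℝ := if x = a then 0 else 1

lemma bdd_neInd {Ω : Type*} (a : Ω) : Bdd (neInd a) := ⟨1, fun x => by unfold neInd; split_ifs <;> simp⟩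

variable {Ω : Type*} [MeasurableSpace Ω] (P : Measure Ω) [IsProbabilityMeasure P]

lemma bdd_integral_cons {n : ℕ} {f : (Fin (n + 1) → Ω) → ℝ} (hf : Bdd f) :
    Bdd (fun x => ∫ v, f (Fin.cons x v) ∂(Measure.pi fun _ : Fin n => P)) :=
  Bdd.integral (hf.imp fun _ h _ _ => h _) _

variable [Countable Ω] [MeasurableSingletonClass Ω]

lemma integral_pi_succ {n : ℕ} {f : (Fin (n + 1) → Ω) → ℝ} (hf : Bdd f) :
    ∫ v, f v ∂(Measure.pi fun _ : Fin (n + 1) => P)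
      = ∫ x, ∫ v, f (Fin.cons x v) ∂(Measure.pi fun _ : Fin n => P) ∂P := by
  rw [← ((measurePreserving_piFinSuccAbove (fun _ : Fin (n + 1) => P) 0).symm).integral_comp']
  rw [integral_prod _ ((hf.comp _).integrable _)]
  simp [MeasurableEquiv.piFinSuccAbove_symm_apply, Fin.insertNthEquiv]

/-- Hoeffding's lemma, with the interval starting at the infimum of `g`. -/
lemma integral_exp_le_of_osc {g : Ω → ℝ} {c : ℝ} (h : ∀ x y, g x - g y ≤ c) (s : ℝ) :
    ∫ x, Real.exp (s * g x) ∂P ≤ Real.exp (s * ∫ x, g x ∂P + s ^ 2 * c ^ 2 / 8) := by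
  obtain ⟨x₀⟩ : Nonempty Ω := nonempty_of_isProbabilityMeasure P
  have hbdd : BddBelow (Set.range g) := ⟨g x₀ - c, by rintro _ ⟨x, rfl⟩; linarith [h x₀ x]⟩
  have : Nonempty Ω := ⟨x₀⟩
  set a := ⨅ x, g x with ha
  have hmem : ∀ x, g x ∈ Set.Icc a (a + c) := fun x => by
    refine ⟨ciInf_le hbdd x, ?_⟩
    have : g x - c ≤ a := le_ciInf fun y => by linarith [h x y]
    linarith
  have hsub := (hasSubgaussianMGF_of_mem_Icc (μ := P) (X := g)
    (Measurable.of_discrete (f := g)).aemeasurable (ae_of_all _ hmem)).mgf_le s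
  have hmgf : mgf (fun x => g x - ∫ y, g y ∂P) P s
      = Real.exp (-(s * ∫ y, g y ∂P)) * ∫ x, Real.exp (s * g x) ∂P := by
    rw [mgf, ← integral_const_mul]
    refine integral_congr_ae (ae_of_all _ fun x => ?_)
    simp only [← Real.exp_add]
    congr 1
    ring
  rw [hmgf, Real.exp_neg, inv_mul_le_iff₀ (Real.exp_pos _), ← Real.exp_add] at hsub
  refine hsub.trans_eq ?_
  congr 2
  simp only [add_sub_cancel_left, NNReal.coe_pow, NNReal.coe_div, coe_nnnorm, NNReal.coe_ofNat,
    Real.norm_eq_abs, div_pow, sq_abs]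
  ring

/-- **McDiarmid's inequality**, in the form of a bound on the moment generating function. -/
lemma integral_exp_le_of_bounded_differences {n : ℕ} {f : (Fin n → Ω) → ℝ} (hf : Bdd f) {c : ℝ}
    (h : ∀ v m y, f (Function.update v m y) - f v ≤ c) (s : ℝ) :
    ∫ v, Real.exp (s * f v) ∂(Measure.pi fun _ : Fin n => P)
      ≤ Real.exp (s * ∫ v, f v ∂(Measure.pi fun _ : Fin n => P) + n * (s ^ 2 * c ^ 2 / 8)) := by
  induction n with
  | zero =>
    have hc : ∀ v, f v = f default := fun v => congrArg f (Subsingleton.elim _ _)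
    simp [hc]
  | succ n ih =>
    rw [integral_pi_succ P ((bdd_const s).mul hf).exp, integral_pi_succ P hf]
    -- Averaging out all coordinates but the first leaves a function of oscillation at most `c`; the
    -- induction hypothesis handles the remaining ones.
    set g : Ω → ℝ := fun x => ∫ v, f (Fin.cons x v) ∂(Measure.pi fun _ : Fin n => P) with hg
    have hgb : Bdd g := bdd_integral_cons P hf
    have h1 : ∀ x, ∫ v, Real.exp (s * f (Fin.cons x v)) ∂(Measure.pi fun _ : Fin n => P)
        ≤ Real.exp (s * g x) * Real.exp (n * (s ^ 2 * c ^ 2 / 8)) := fun x => by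
      rw [← Real.exp_add]
      refine ih (f := fun v => f (Fin.cons x v)) (hf.comp _) fun v m y => ?_
      simpa only [Fin.cons_update] using h (Fin.cons x v) m.succ y
    have h2 : ∀ x y, g x - g y ≤ c := fun x y => by
      rw [hg, ← integral_sub ((hf.comp _).integrable _) ((hf.comp _).integrable _)]
      refine (integral_mono (((hf.comp _).sub (hf.comp _)).integrable _) (integrable_const c)
        fun v => ?_).trans_eq (by simp)
      simpa using h (Fin.cons y v) 0 x
    calc _ ≤ ∫ x, Real.exp (s * g x) * Real.exp (n * (s ^ 2 * c ^ 2 / 8)) ∂P :=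
          integral_mono ((bdd_integral_cons P ((bdd_const s).mul hf).exp).integrable _)
            (((((bdd_const s).mul hgb).exp).mul (bdd_const _)).integrable _) h1
      _ = (∫ x, Real.exp (s * g x) ∂P) * Real.exp (n * (s ^ 2 * c ^ 2 / 8)) :=
          integral_mul_const _ _
      _ ≤ Real.exp (s * ∫ x, g x ∂P + s ^ 2 * c ^ 2 / 8)
            * Real.exp (n * (s ^ 2 * c ^ 2 / 8)) := by
          gcongr; exact integral_exp_le_of_osc P h2 s
      _ = _ := by rw [← Real.exp_add]; congr 1; push_cast; ring

lemma integral_neInd_mul_add (a : Ω) {g : Ω → ℝ} (hg : Bdd g) :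
    ∫ x, g x ∂P = ∫ x, neInd a x * g x ∂P + P.real {a} * g a := by
  classical
  have h : ∀ x, g x = neInd a x * g x + ({a} : Set Ω).indicator (fun _ => g a) x := fun x => by
    by_cases hx : x = a <;> simp [neInd, hx]
  have hi : Integrable (({a} : Set Ω).indicator (fun _ => g a)) P :=
    (integrable_const _).indicator (measurableSet_singleton a)
  calc ∫ x, g x ∂P = ∫ x, (neInd a x * g x + ({a} : Set Ω).indicator (fun _ => g a) x) ∂P :=
        integral_congr_ae (ae_of_all _ h)
    _ = _ := by
        rw [integral_add (((bdd_neInd a).mul hg).integrable _) hi,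
          integral_indicator_const _ (measurableSet_singleton a), smul_eq_mul]

lemma integral_neInd (a : Ω) : ∫ x, neInd a x ∂P = 1 - P.real {a} := by
  have := integral_neInd_mul_add P a (bdd_const 1)
  simp at this
  linarith

/-- Excluding the point where `g` is largest cannot raise its conditional mean. This is the
one-coordinate case of negative dependence. -/
lemma integral_neInd_mul_le (a : Ω) {g : Ω → ℝ} (hg : Bdd g) (h : ∀ y, g y ≤ g a) :
    ∫ x, neInd a x * g x ∂P ≤ (1 - P.real {a}) * ∫ x, g x ∂P := by
  have h1 := integral_neInd_mul_add P a hg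
  have h2 : ∫ x, neInd a x * g x ∂P ≤ (1 - P.real {a}) * g a := by
    rw [← integral_neInd, ← integral_mul_const]
    refine integral_mono (((bdd_neInd a).mul hg).integrable _)
      (((bdd_neInd a).mul (bdd_const _)).integrable _) fun x => ?_
    have : 0 ≤ neInd a x := by unfold neInd; split_ifs <;> simp
    exact mul_le_mul_of_nonneg_left (h x) this
  have h3 : 0 ≤ P.real {a} := measureReal_nonneg
  rw [h1]
  nlinarith

end Product

/-! ### Combinatorics of occurrence counts -/

section Sample

variable {Ω : Type*} {n : ℕ}

lemma occ_eq_zero_iff (x : Fin n → Ω) (a : Ω) : occ x a = 0 ↔ ∀ m, x m ≠ a := by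
  classical
  simp [occ]

lemma occ_cons_self (a : Ω) (x : Fin n → Ω) :
    occ (Fin.cons a x : Fin (n + 1) → Ω) a = occ x a + 1 := by
  classical
  rw [occ, Fin.sum_univ_succ, add_comm]
  simp [occ]

lemma occ_cons_of_ne {y a : Ω} (h : y ≠ a) (x : Fin n → Ω) :
    occ (Fin.cons y x : Fin (n + 1) → Ω) a = occ x a := by
  classical
  rw [occ, Fin.sum_univ_succ]
  simp [occ, h]

lemma unseen_cons (y : Ω) (x : Fin n → Ω) (a : Ω) :
    unseen (Fin.cons y x : Fin (n + 1) → Ω) a = neInd a y * unseen x a := by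
  by_cases h : y = a
  · subst h
    simp [unseen, occ_cons_self, neInd]
  · simp [unseen, occ_cons_of_ne h, neInd, h]

lemma seenOnce_cons (y : Ω) (x : Fin n → Ω) (a : Ω) :
    seenOnce (Fin.cons y x : Fin (n + 1) → Ω) a
      = neInd a y * seenOnce x a + (1 - neInd a y) * unseen x a := by
  by_cases h : y = a
  · subst h
    simp [seenOnce, unseen, occ_cons_self, neInd]
  · simp [seenOnce, occ_cons_of_ne h, neInd, h]

lemma unseen_nonneg (x : Fin n → Ω) (a : Ω) : 0 ≤ unseen x a := by
  unfold unseen; split_ifs <;> simp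

lemma unseen_le_one (x : Fin n → Ω) (a : Ω) : unseen x a ≤ 1 := by
  unfold unseen; split_ifs <;> simp

lemma seenOnce_nonneg (x : Fin n → Ω) (a : Ω) : 0 ≤ seenOnce x a := by
  unfold seenOnce; split_ifs <;> simp

lemma seenOnce_le_one (x : Fin n → Ω) (a : Ω) : seenOnce x a ≤ 1 := by
  unfold seenOnce; split_ifs <;> simp

lemma bdd_unseen (a : Ω) : Bdd (fun x : Fin n → Ω => unseen x a) :=
  ⟨1, fun x => by rw [abs_of_nonneg (unseen_nonneg _ _)]; exact unseen_le_one _ _⟩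

lemma bdd_seenOnce (a : Ω) : Bdd (fun x : Fin n → Ω => seenOnce x a) :=
  ⟨1, fun x => by rw [abs_of_nonneg (seenOnce_nonneg _ _)]; exact seenOnce_le_one _ _⟩

/-- Replacing an occurrence of an item can only make the other items more seen. -/
lemma unseen_update_le {x : Fin n → Ω} {m : Fin n} {a : Ω} (h : x m ≠ a) (y : Ω) :
    unseen (Function.update x m y) a ≤ unseen x a := by
  by_cases h0 : occ (Function.update x m y) a = 0
  · have : occ x a = 0 := by
      rw [occ_eq_zero_iff] at h0 ⊢
      intro k
      rcases eq_or_ne k m with rfl | hk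
      · exact h
      · simpa [hk] using h0 k
    simp [unseen, this, h0]
  · simp only [unseen, h0, if_false]
    split_ifs <;> simp

lemma occ_update_of_ne {x : Fin n → Ω} {m : Fin n} {a y : Ω} (h : x m ≠ a) (hy : y ≠ a) :
    occ (Function.update x m y) a = occ x a := by
  classical
  refine Finset.sum_congr rfl fun k _ => ?_
  rcases eq_or_ne k m with rfl | hk
  · simp [h, hy]
  · simp [hk]

/-- `T` is left free so that two samples can be compared over a common finite set. -/
lemma hapaxCount_eq_sum (A : Set Ω) {x : Fin n → Ω} {T : Finset Ω} (hT : ∀ m, x m ∈ T) :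
    hapaxCount A x = ∑ a ∈ T, A.indicator (seenOnce x) a := by
  classical
  rw [hapaxCount, tsum_subtype A (seenOnce x), tsum_eq_sum]
  intro a ha
  have : occ x a = 0 := (occ_eq_zero_iff x a).2 fun m hm => ha (hm ▸ hT m)
  rw [Set.indicator_apply, seenOnce, this]
  simp

lemma hapaxCount_nonneg (A : Set Ω) (x : Fin n → Ω) : 0 ≤ hapaxCount A x :=
  tsum_nonneg fun _ => seenOnce_nonneg _ _

lemma hapaxCount_le (A : Set Ω) (x : Fin n → Ω) : hapaxCount A x ≤ n := by
  classical
  rw [hapaxCount_eq_sum A (T := Finset.univ.image x) (by simp)]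
  calc ∑ a ∈ Finset.univ.image x, A.indicator (seenOnce x) a
      ≤ ∑ a ∈ Finset.univ.image x, (1 : ℝ) := Finset.sum_le_sum fun a _ =>
        (Set.indicator_le_self' (fun _ _ => seenOnce_nonneg _ _) a).trans (seenOnce_le_one _ _)
    _ ≤ n := by
        simp only [Finset.sum_const, nsmul_eq_mul, mul_one]
        exact_mod_cast Finset.card_image_le.trans_eq (by simp)

/-- Only the old value `x m` and the new value `y` can change status. -/
lemma hapaxCount_update_sub_le (A : Set Ω) (x : Fin n → Ω) (m : Fin n) (y : Ω) :
    hapaxCount A (Function.update x m y) - hapaxCount A x ≤ 2 := by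
  classical
  set T := insert y (Finset.univ.image x) with hT
  rw [hapaxCount_eq_sum A (T := T) (x := x) (by simp [hT]),
    hapaxCount_eq_sum A (T := T) (x := Function.update x m y)
      (fun k => by rcases eq_or_ne k m with rfl | hk <;> simp [*]), ← Finset.sum_sub_distrib]
  calc ∑ a ∈ T, (A.indicator (seenOnce (Function.update x m y)) a - A.indicator (seenOnce x) a)
      ≤ ∑ a ∈ T, if a ∈ ({x m, y} : Finset Ω) then (1 : ℝ) else 0 := by
        refine Finset.sum_le_sum fun a _ => ?_
        split_ifs with ha
        · have h1 : A.indicator (seenOnce (Function.update x m y)) a ≤ 1 :=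
            (Set.indicator_le_self' (fun _ _ => seenOnce_nonneg _ _) a).trans (seenOnce_le_one _ _)
          have h2 : 0 ≤ A.indicator (seenOnce x) a :=
            Set.indicator_nonneg (fun _ _ => seenOnce_nonneg _ _) a
          linarith
        · simp only [Finset.mem_insert, Finset.mem_singleton, not_or] at ha
          simp [Set.indicator_apply, seenOnce, occ_update_of_ne (Ne.symm ha.1) (Ne.symm ha.2)]
    _ = ((T.filter (· ∈ ({x m, y} : Finset Ω))).card : ℝ) := by simp
    _ ≤ 2 := by
        have h1 : (T.filter (· ∈ ({x m, y} : Finset Ω))).card ≤ ({x m, y} : Finset Ω).card :=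
          Finset.card_le_card fun a ha => (Finset.mem_filter.1 ha).2
        exact_mod_cast h1.trans Finset.card_le_two

lemma estimator_nonneg (A : Set Ω) (x : Fin n → Ω) : 0 ≤ estimator A x :=
  div_nonneg (hapaxCount_nonneg A x) (Nat.cast_nonneg n)

lemma bdd_estimator (A : Set Ω) : Bdd (fun x : Fin n → Ω => estimator A x) :=
  ⟨1, fun x => by
    rw [abs_of_nonneg (estimator_nonneg A x)]
    exact div_le_one_of_le₀ (hapaxCount_le A x) (Nat.cast_nonneg n)⟩

lemma estimator_update_sub_le (A : Set Ω) (x : Fin n → Ω) (m : Fin n) (y : Ω) :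
    estimator A (Function.update x m y) - estimator A x ≤ 2 / n := by
  rw [estimator, estimator, ← sub_div]
  gcongr
  exact hapaxCount_update_sub_le A x m y

end Sample

/-! ### Expectations, negative dependence and sub-Gaussian bounds -/

section Expectation

variable {Ω : Type*} [MeasurableSpace Ω] (P : Measure Ω) [IsProbabilityMeasure P] {n : ℕ}

lemma one_sub_real_singleton_mem (a : Ω) (k : ℕ) :
    0 ≤ (1 - P.real {a}) ^ k ∧ (1 - P.real {a}) ^ k ≤ 1 := by
  have h : P.real {a} ≤ 1 := measureReal_le_one
  have h0 : 0 ≤ P.real {a} := measureReal_nonneg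
  exact ⟨pow_nonneg (by linarith) k, pow_le_one₀ (by linarith) (by linarith)⟩

variable [MeasurableSingletonClass Ω]

lemma sum_real_singleton_le_one {A : Set Ω} (F : Finset A) :
    ∑ a ∈ F, P.real {(a : Ω)} ≤ 1 := by
  have := sum_measureReal_singleton (μ := P) (F.map (Function.Embedding.subtype _))
  rw [Finset.sum_map] at this
  exact this.trans_le measureReal_le_one

lemma summable_real_singleton (A : Set Ω) : Summable fun a : A => P.real {(a : Ω)} :=
  summable_of_sum_le (fun _ => measureReal_nonneg) (sum_real_singleton_le_one P)

lemma tsum_real_singleton_le_one (A : Set Ω) : ∑' a : A, P.real {(a : Ω)} ≤ 1 :=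
  (summable_real_singleton P A).tsum_le_of_sum_le (sum_real_singleton_le_one P)


lemma summable_missingMass (A : Set Ω) (v : Fin n → Ω) :
    Summable fun a : A => unseen v (a : Ω) * P.real {(a : Ω)} :=
  (summable_real_singleton P A).of_nonneg_of_le
    (fun _ => mul_nonneg (unseen_nonneg _ _) measureReal_nonneg)
    (fun _ => mul_le_of_le_one_left measureReal_nonneg (unseen_le_one _ _))

lemma bdd_missingMass (A : Set Ω) : Bdd (fun v : Fin n → Ω => missingMass P A v) :=
  ⟨1, fun v => by
    have h0 : 0 ≤ missingMass P A v :=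
      tsum_nonneg fun _ => mul_nonneg (unseen_nonneg _ _) measureReal_nonneg
    rw [abs_of_nonneg h0]
    exact ((summable_missingMass P A v).tsum_le_tsum
      (fun _ => mul_le_of_le_one_left measureReal_nonneg (unseen_le_one _ _))
      (summable_real_singleton P A)).trans (tsum_real_singleton_le_one P A)⟩

variable [Countable Ω]

/-- Conditioning on an item `a` being unseen decreases the expectation of every function that
decreases when occurrences of `a` are replaced by other items. -/
lemma integral_unseen_mul_le (a : Ω) {f : (Fin n → Ω) → ℝ} (hf : Bdd f)
    (h : ∀ v m y, v m = a → f (Function.update v m y) ≤ f v) :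
    ∫ v, unseen v a * f v ∂(Measure.pi fun _ : Fin n => P)
      ≤ (1 - P.real {a}) ^ n * ∫ v, f v ∂(Measure.pi fun _ : Fin n => P) := by
  induction n with
  | zero =>
    simp [unseen, occ]
  | succ n ih =>
    rw [integral_pi_succ P ((bdd_unseen a).mul hf), integral_pi_succ P hf]
    set g : Ω → ℝ := fun x => ∫ v, f (Fin.cons x v) ∂(Measure.pi fun _ : Fin n => P) with hg
    have hgb : Bdd g := bdd_integral_cons P hf
    have h1 : ∀ x, ∫ v, unseen (Fin.cons x v : Fin (n + 1) → Ω) a * f (Fin.cons x v)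
        ∂(Measure.pi fun _ : Fin n => P) ≤ neInd a x * ((1 - P.real {a}) ^ n * g x) := fun x => by
      simp only [unseen_cons, mul_assoc]
      rw [integral_const_mul]
      refine mul_le_mul_of_nonneg_left (ih (f := fun v => f (Fin.cons x v)) (hf.comp _) ?_)
        (by unfold neInd; split_ifs <;> simp)
      intro v m y hv
      simpa only [Fin.cons_update] using h (Fin.cons x v) m.succ y (by simpa using hv)
    have h2 : ∀ y, g y ≤ g a := fun y =>
      integral_mono ((hf.comp _).integrable _) ((hf.comp _).integrable _) fun v => by
        simpa using h (Fin.cons a v) 0 y rfl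
    have hq : 0 ≤ 1 - P.real {a} := by linarith [measureReal_le_one (μ := P) (s := {a})]
    calc _ ≤ ∫ x, neInd a x * ((1 - P.real {a}) ^ n * g x) ∂P :=
          integral_mono ((bdd_integral_cons P ((bdd_unseen a).mul hf)).integrable _)
            (((bdd_neInd a).mul ((bdd_const _).mul hgb)).integrable _) h1
      _ = (1 - P.real {a}) ^ n * ∫ x, neInd a x * g x ∂P := by
          rw [← integral_const_mul]; congr 1 with x; ring
      _ ≤ (1 - P.real {a}) ^ n * ((1 - P.real {a}) * ∫ x, g x ∂P) := by
          gcongr; exact integral_neInd_mul_le P a hgb h2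
      _ = _ := by ring

lemma integral_unseen (a : Ω) :
    ∫ v, unseen v a ∂(Measure.pi fun _ : Fin n => P) = (1 - P.real {a}) ^ n := by
  induction n with
  | zero => simp [unseen, occ]
  | succ n ih =>
    rw [integral_pi_succ P (bdd_unseen a)]
    simp only [unseen_cons, integral_const_mul, ih]
    rw [integral_mul_const, integral_neInd, pow_succ']

lemma integral_seenOnce (a : Ω) :
    ∫ v, seenOnce v a ∂(Measure.pi fun _ : Fin n => P)
      = n * (P.real {a} * (1 - P.real {a}) ^ (n - 1)) := by
  induction n with
  | zero => simp [seenOnce, occ]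
  | succ n ih =>
    rw [integral_pi_succ P (bdd_seenOnce a)]
    have h : ∀ x : Ω, ∫ v, seenOnce (Fin.cons x v : Fin (n + 1) → Ω) a
        ∂(Measure.pi fun _ : Fin n => P)
        = neInd a x * (n * (P.real {a} * (1 - P.real {a}) ^ (n - 1)))
          + (1 - neInd a x) * (1 - P.real {a}) ^ n := fun x => by
      simp only [seenOnce_cons]
      rw [integral_add (((bdd_const _).mul (bdd_seenOnce a)).integrable _)
        (((bdd_const _).mul (bdd_unseen a)).integrable _), integral_const_mul, integral_const_mul,
        ih, integral_unseen]
    simp only [h]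
    rw [integral_add (((bdd_neInd a).mul (bdd_const _)).integrable _)
      ((((bdd_const 1).sub (bdd_neInd a)).mul (bdd_const _)).integrable _), integral_mul_const,
      integral_mul_const, integral_sub (integrable_const _) ((bdd_neInd a).integrable _),
      integral_neInd]
    cases n with
    | zero => simp
    | succ n => simp [pow_succ]; ring

/-- Items are peeled off one at a time: an unseen `a` leaves more draws to the others, so the unseen
indicators behave no worse than independent ones. -/
lemma integral_exp_sum_unseen_le_prod (F : Finset Ω) (t : ℝ) :
    ∫ v, Real.exp (t * ∑ a ∈ F, unseen v a * P.real {a}) ∂(Measure.pi fun _ : Fin n => P)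
      ≤ ∏ a ∈ F, (1 + (Real.exp (t * P.real {a}) - 1) * (1 - P.real {a}) ^ n) := by
  classical
  induction F using Finset.induction_on with
  | empty => simp
  | insert a F ha ih =>
    rw [Finset.prod_insert ha]
    set H : (Fin n → Ω) → ℝ := fun v => Real.exp (t * ∑ a ∈ F, unseen v a * P.real {a}) with hH
    set q := (1 - P.real {a}) ^ n with hq
    have hsum : Bdd (fun v : Fin n → Ω => ∑ a ∈ F, unseen v a * P.real {a}) :=
      Bdd.sum F fun i _ => (bdd_unseen i).mul (bdd_const _)
    have hHb : Bdd H := ((bdd_const t).mul hsum).exp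
    have hmono : ∀ (v : Fin n → Ω) m y, v m = a → ∑ a ∈ F, unseen (Function.update v m y) a * P.real {a}
        ≤ ∑ a ∈ F, unseen v a * P.real {a} := fun v m y hv =>
      Finset.sum_le_sum fun b hb => mul_le_mul_of_nonneg_right
        (unseen_update_le (by rw [hv]; rintro rfl; exact ha hb) y) measureReal_nonneg
    -- An indicator `Z` satisfies `exp (t * w * Z) = 1 + (exp (t * w) - 1) * Z`.
    have hsplit : ∀ v : Fin n → Ω, Real.exp (t * ∑ a ∈ insert a F, unseen v a * P.real {a})
        = H v + (Real.exp (t * P.real {a}) - 1) * (unseen v a * H v) := fun v => by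
      rw [Finset.sum_insert ha, mul_add, Real.exp_add]
      by_cases h0 : occ v a = 0 <;> simp [unseen, h0, hH] <;> ring
    have hpeel : (Real.exp (t * P.real {a}) - 1)
          * ∫ v, unseen v a * H v ∂(Measure.pi fun _ : Fin n => P)
        ≤ (Real.exp (t * P.real {a}) - 1)
          * (q * ∫ v, H v ∂(Measure.pi fun _ : Fin n => P)) := by
      have hw : 0 ≤ P.real {a} := measureReal_nonneg
      -- For `t ≤ 0` it is `-H` that decreases when copies of `a` are replaced, but the prefactor is
      -- then nonpositive too, so the inequality keeps its direction.
      rcases le_total 0 t with ht | ht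
      · refine mul_le_mul_of_nonneg_left (integral_unseen_mul_le P a hHb fun v m y hv => ?_) ?_
        · exact Real.exp_le_exp.2 (mul_le_mul_of_nonneg_left (hmono v m y hv) ht)
        · exact sub_nonneg.2 (Real.one_le_exp (by positivity))
      · refine mul_le_mul_of_nonpos_left ?_
          (sub_nonpos.2 (Real.exp_le_one_iff.2 (mul_nonpos_of_nonpos_of_nonneg ht hw)))
        have := integral_unseen_mul_le P a hHb.neg fun v m y hv => neg_le_neg
          (Real.exp_le_exp.2 (mul_le_mul_of_nonpos_left (hmono v m y hv) ht))
        simp only [mul_neg, integral_neg] at this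
        exact neg_le_neg_iff.1 this
    have hw : 0 ≤ P.real {a} := measureReal_nonneg
    have hw1 : P.real {a} ≤ 1 := measureReal_le_one
    have hq0 : 0 ≤ q := pow_nonneg (by linarith) n
    have hq1 : q ≤ 1 := pow_le_one₀ (by linarith) (by linarith)
    have hfac : 0 ≤ 1 + (Real.exp (t * P.real {a}) - 1) * q := by
      nlinarith [Real.exp_pos (t * P.real {a})]
    calc _ = ∫ v, H v ∂(Measure.pi fun _ : Fin n => P) + (Real.exp (t * P.real {a}) - 1)
            * ∫ v, unseen v a * H v ∂(Measure.pi fun _ : Fin n => P) := by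
          simp only [hsplit]
          rw [integral_add (hHb.integrable _)
            (((bdd_const _).mul ((bdd_unseen a).mul hHb)).integrable _), integral_const_mul]
      _ ≤ (1 + (Real.exp (t * P.real {a}) - 1) * q)
            * ∫ v, H v ∂(Measure.pi fun _ : Fin n => P) := by linarith
      _ ≤ _ := mul_le_mul_of_nonneg_left ih hfac

lemma hasSum_integral_missingMass (A : Set Ω) :
    HasSum (fun a : A => P.real {(a : Ω)} * (1 - P.real {(a : Ω)}) ^ n)
      (∫ v, missingMass P A v ∂(Measure.pi fun _ : Fin n => P)) := by
  have hi : ∀ a : A, ∫ v, unseen v (a : Ω) * P.real {(a : Ω)} ∂(Measure.pi fun _ : Fin n => P)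
      = P.real {(a : Ω)} * (1 - P.real {(a : Ω)}) ^ n := fun a => by
    rw [integral_mul_const, integral_unseen, mul_comm]
  have h := hasSum_integral_of_summable_integral_norm (μ := Measure.pi fun _ : Fin n => P)
    (F := fun (a : A) v => unseen v (a : Ω) * P.real {(a : Ω)})
    (fun a => ((bdd_unseen _).mul (bdd_const _)).integrable _) (by
      simp only [Real.norm_of_nonneg (mul_nonneg (unseen_nonneg _ _) measureReal_nonneg), hi]
      exact (summable_real_singleton P A).of_nonneg_of_le
        (fun a => mul_nonneg measureReal_nonneg (one_sub_real_singleton_mem P a n).1)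
        (fun a => mul_le_of_le_one_right measureReal_nonneg (one_sub_real_singleton_mem P a n).2))
  simp only [hi] at h
  exact h

lemma hasSum_integral_estimator (A : Set Ω) (hn : 1 ≤ n) :
    HasSum (fun a : A => P.real {(a : Ω)} * (1 - P.real {(a : Ω)}) ^ (n - 1))
      (∫ v, estimator A v ∂(Measure.pi fun _ : Fin n => P)) := by
  have hn' : (n : ℝ) ≠ 0 := by positivity
  have hi : ∀ a : A, ∫ v, seenOnce v (a : Ω) / (n : ℝ) ∂(Measure.pi fun _ : Fin n => P)
      = P.real {(a : Ω)} * (1 - P.real {(a : Ω)}) ^ (n - 1) := fun a => by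
    rw [integral_div, integral_seenOnce, mul_div_cancel_left₀ _ hn']
  have h := hasSum_integral_of_summable_integral_norm (μ := Measure.pi fun _ : Fin n => P)
    (F := fun (a : A) v => seenOnce v (a : Ω) / (n : ℝ))
    (fun a => by
      simp only [div_eq_mul_inv]
      exact ((bdd_seenOnce _).mul (bdd_const _)).integrable _) (by
      simp only [Real.norm_of_nonneg (div_nonneg (seenOnce_nonneg _ _) (Nat.cast_nonneg n)), hi]
      exact (summable_real_singleton P A).of_nonneg_of_le
        (fun a => mul_nonneg measureReal_nonneg (one_sub_real_singleton_mem P a _).1)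
        (fun a => mul_le_of_le_one_right measureReal_nonneg (one_sub_real_singleton_mem P a _).2))
  simp only [hi, tsum_div_const] at h
  exact h

/-- The Good-Turing estimator overestimates the missing mass by at most `1 / n` on average. -/
lemma integral_estimator_bias (A : Set Ω) (hn : 1 ≤ n) :
    ∫ v, missingMass P A v ∂(Measure.pi fun _ : Fin n => P)
        ≤ ∫ v, estimator A v ∂(Measure.pi fun _ : Fin n => P) ∧
      ∫ v, estimator A v ∂(Measure.pi fun _ : Fin n => P) - 1 / n
        ≤ ∫ v, missingMass P A v ∂(Measure.pi fun _ : Fin n => P) := by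
  have hn' : (0 : ℝ) < n := by exact_mod_cast hn
  have hR := hasSum_integral_missingMass P (n := n) A
  have hE := hasSum_integral_estimator P A hn
  have hpow : ∀ a : Ω, (1 - P.real {a}) ^ n = (1 - P.real {a}) ^ (n - 1) * (1 - P.real {a}) :=
    fun a => by rw [← pow_succ]; congr 1; omega
  constructor
  · refine hasSum_le (fun a => ?_) hR hE
    have h0 : 0 ≤ P.real {(a : Ω)} := measureReal_nonneg
    rw [hpow]
    exact mul_le_mul_of_nonneg_left
      (mul_le_of_le_one_right (one_sub_real_singleton_mem P a _).1 (by linarith)) h0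
  · have h : ∫ v, estimator A v ∂(Measure.pi fun _ : Fin n => P)
        - ∫ v, missingMass P A v ∂(Measure.pi fun _ : Fin n => P)
        ≤ 1 / n * ∑' a : A, P.real {(a : Ω)} := by
      refine hasSum_le (fun a => ?_) (hE.sub hR)
        ((summable_real_singleton P A).hasSum.mul_left (1 / (n : ℝ)))
      have h0 : 0 ≤ P.real {(a : Ω)} := measureReal_nonneg
      -- The bias of one item is `w ^ 2 * (1 - w) ^ (n - 1)`; since `n * w * (1 - w) ^ (n - 1)` is a
      -- probability, this is at most `w / n`.
      have h1 : n * (P.real {(a : Ω)} * (1 - P.real {(a : Ω)}) ^ (n - 1)) ≤ 1 := by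
        rw [← integral_seenOnce]
        exact (integral_mono ((bdd_seenOnce _).integrable _) (integrable_const (1 : ℝ))
          fun v => seenOnce_le_one v (a : Ω)).trans_eq (by simp)
      rw [hpow, one_div, ← div_eq_inv_mul, le_div_iff₀ hn']
      nlinarith
    have h' : 1 / n * ∑' a : A, P.real {(a : Ω)} ≤ 1 / n :=
      mul_le_of_le_one_right (by positivity) (tsum_real_singleton_le_one P A)
    linarith

/-- The product bound covers finite sets of items; dominated convergence, with dominating constant
`exp |t|`, passes to all of `A`. -/
lemma integral_exp_missingMass_le (A : Set Ω) (hn : 1 ≤ n) (t : ℝ) :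
    ∫ v, Real.exp (t * missingMass P A v) ∂(Measure.pi fun _ : Fin n => P)
      ≤ Real.exp (t * ∫ v, missingMass P A v ∂(Measure.pi fun _ : Fin n => P)
          + t ^ 2 / (4 * n)) := by
  have hlim : Filter.Tendsto (fun F : Finset A =>
      ∫ v, Real.exp (t * ∑ a ∈ F, unseen v (a : Ω) * P.real {(a : Ω)})
        ∂(Measure.pi fun _ : Fin n => P)) Filter.atTop
      (nhds (∫ v, Real.exp (t * missingMass P A v) ∂(Measure.pi fun _ : Fin n => P))) := by
    refine tendsto_integral_filter_of_dominated_convergence (fun _ => Real.exp |t|)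
      (Filter.Eventually.of_forall fun F => Measurable.of_discrete.aestronglyMeasurable)
      (Filter.Eventually.of_forall fun F => ae_of_all _ fun v => ?_) (integrable_const _)
      (ae_of_all _ fun v => ?_)
    · rw [Real.norm_of_nonneg (Real.exp_pos _).le, Real.exp_le_exp]
      refine (le_abs_self _).trans ?_
      rw [abs_mul]
      refine mul_le_of_le_one_right (abs_nonneg _) ?_
      rw [abs_of_nonneg (Finset.sum_nonneg fun _ _ =>
        mul_nonneg (unseen_nonneg _ _) measureReal_nonneg)]
      exact (Finset.sum_le_sum fun _ _ => mul_le_of_le_one_left measureReal_nonneg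
        (unseen_le_one _ _)).trans (sum_real_singleton_le_one P F)
    · exact (Real.continuous_exp.tendsto _).comp
        ((summable_missingMass P A v).hasSum.const_mul t)
  have hlim' : Filter.Tendsto (fun F : Finset A =>
      Real.exp (t * ∑ a ∈ F, P.real {(a : Ω)} * (1 - P.real {(a : Ω)}) ^ n + t ^ 2 / (4 * n)))
      Filter.atTop (nhds (Real.exp (t * ∫ v, missingMass P A v ∂(Measure.pi fun _ : Fin n => P)
          + t ^ 2 / (4 * n)))) :=
    (Real.continuous_exp.tendsto _).comp
      (((hasSum_integral_missingMass P A).const_mul t).add_const _)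
  refine le_of_tendsto_of_tendsto' hlim hlim' fun F => ?_
  have h := integral_exp_sum_unseen_le_prod P (n := n) (F.map (Function.Embedding.subtype _)) t
  simp only [Finset.sum_map, Finset.prod_map, Function.Embedding.subtype_apply] at h
  refine h.trans ((Finset.prod_le_prod (fun a _ => ?_) fun a _ =>
    unseen_factor_le measureReal_nonneg measureReal_le_one hn t).trans ?_)
  · have := one_sub_real_singleton_mem P (a : Ω) n
    nlinarith [Real.exp_pos (t * P.real {(a : Ω)})]
  · rw [← Real.exp_sum, Real.exp_le_exp, Finset.sum_add_distrib, ← Finset.mul_sum,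
      ← Finset.mul_sum]
    gcongr
    exact mul_le_of_le_one_right (by positivity) (sum_real_singleton_le_one P F)

lemma hasSubgaussianMGF_missingMass (A : Set Ω) (hn : 1 ≤ n) :
    HasSubgaussianMGF (fun v => missingMass P A v
      - ∫ v, missingMass P A v ∂(Measure.pi fun _ : Fin n => P)) (1 / (2 * n))
      (Measure.pi fun _ : Fin n => P) where
  integrable_exp_mul t :=
    ((bdd_const t).mul ((bdd_missingMass P A).sub (bdd_const _))).exp.integrable _
  mgf_le t := by
    simp only [mgf, mul_sub, Real.exp_sub]
    rw [integral_div, div_le_iff₀ (Real.exp_pos _), ← Real.exp_add]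
    refine (integral_exp_missingMass_le P A hn t).trans_eq ?_
    congr 1
    push_cast
    ring

lemma hasSubgaussianMGF_estimator (A : Set Ω) (hn : 1 ≤ n) :
    HasSubgaussianMGF (fun v => estimator A v
      - ∫ v, estimator A v ∂(Measure.pi fun _ : Fin n => P)) (1 / n)
      (Measure.pi fun _ : Fin n => P) where
  integrable_exp_mul t :=
    ((bdd_const t).mul ((bdd_estimator A).sub (bdd_const _))).exp.integrable _
  mgf_le t := by
    have hn' : (n : ℝ) ≠ 0 := by positivity
    simp only [mgf, mul_sub, Real.exp_sub]
    rw [integral_div, div_le_iff₀ (Real.exp_pos _), ← Real.exp_add]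
    -- With `c = 2 / n`, the exponent `n * (t ^ 2 * c ^ 2 / 8)` is `t ^ 2 / (2 * n)`.
    refine (integral_exp_le_of_bounded_differences P (bdd_estimator A)
      (estimator_update_sub_le A) t).trans_eq ?_
    congr 1
    push_cast
    field_simp
    ring

end Expectation

/-! ### Chernoff and union bounds -/

/-- A two-sided Chernoff bound at the deviation level `√(2 c L)`. -/
lemma measureReal_abs_ge_le_of_hasSubgaussianMGF {α : Type*} [MeasurableSpace α] {ν : Measure α}
    [IsFiniteMeasure ν] {f : α → ℝ} {c : NNReal} (h : HasSubgaussianMGF f c ν) (hc : 0 < c)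
    {ε L : ℝ} (hε : 0 ≤ ε) (hL : ε ^ 2 = 2 * c * L) :
    ν.real {x | ε ≤ |f x|} ≤ 2 * Real.exp (-L) := by
  have hc' : (0 : ℝ) < c := hc
  have e : -ε ^ 2 / (2 * c) = -L := by rw [hL]; field_simp
  have h1 := h.measure_ge_le hε
  have h2 := h.neg.measure_ge_le hε
  rw [e] at h1 h2
  have hsub : {x | ε ≤ |f x|} ⊆ {x | ε ≤ f x} ∪ {x | ε ≤ (-f) x} := fun x hx => by
    rcases le_abs.1 (show ε ≤ |f x| from hx) with h | h
    · exact Or.inl h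
    · exact Or.inr h
  calc ν.real {x | ε ≤ |f x|} ≤ ν.real ({x | ε ≤ f x} ∪ {x | ε ≤ (-f) x}) := measureReal_mono hsub
    _ ≤ ν.real {x | ε ≤ f x} + ν.real {x | ε ≤ (-f) x} := measureReal_union_le _ _
    _ ≤ 2 * Real.exp (-L) := by linarith

theorem le_measureReal_pi {Ω : Type*} [Countable Ω] [MeasurableSpace Ω] [MeasurableSingletonClass Ω]
    (P : Measure Ω) [IsProbabilityMeasure P] (A : Set Ω) (n : ℕ) (hn : 1 ≤ n) (δ : ℝ) (hδ : 0 < δ)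
    (hδ1 : δ < 1) :
    1 - δ ≤ (Measure.pi fun _ : Fin n => P).real {v |
      estimator A v - 1 / (n : ℝ) - (1 + Real.sqrt 2) * Real.sqrt (Real.log (4 / δ) / (n : ℝ))
        ≤ missingMass P A v ∧
      missingMass P A v
        ≤ estimator A v + (1 + Real.sqrt 2) * Real.sqrt (Real.log (4 / δ) / (n : ℝ))} := by
  have hn' : (0 : ℝ) < n := by exact_mod_cast hn
  have hnn : (0 : NNReal) < n := by exact_mod_cast hn
  set ν := Measure.pi fun _ : Fin n => P
  set L := Real.log (4 / δ) with hLdef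
  set r := Real.sqrt (L / n) with hr
  have hL : 0 ≤ L := Real.log_nonneg (by rw [le_div_iff₀ hδ]; linarith)
  have hr2 : r ^ 2 = L / n := Real.sq_sqrt (by positivity)
  have hexp : Real.exp (-L) = δ / 4 := by
    rw [Real.exp_neg, hLdef, Real.exp_log (by positivity), inv_div]
  -- Both levels have the form `√(2 * proxy * L)`, with proxies `1 / (2 * n)` and `1 / n`; each tail
  -- is at most `2 * (δ / 4)`.
  have hR := measureReal_abs_ge_le_of_hasSubgaussianMGF (hasSubgaussianMGF_missingMass P A hn)
    (by positivity) (ε := r) (L := L) (Real.sqrt_nonneg _) (by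
      rw [hr2]; push_cast; field_simp)
  have hE := measureReal_abs_ge_le_of_hasSubgaussianMGF (hasSubgaussianMGF_estimator P A hn)
    (by positivity) (ε := Real.sqrt 2 * r) (L := L) (by positivity) (by
      rw [mul_pow, hr2, Real.sq_sqrt (by norm_num)]; push_cast; field_simp)
  rw [hexp] at hR hE
  obtain ⟨hb1, hb2⟩ := integral_estimator_bias P A hn
  set mR := ∫ v, missingMass P A v ∂ν
  set mE := ∫ v, estimator A v ∂ν
  set G := {v : Fin n → Ω | estimator A v - 1 / (n : ℝ) - (1 + Real.sqrt 2) * r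
    ≤ missingMass P A v ∧ missingMass P A v ≤ estimator A v + (1 + Real.sqrt 2) * r} with hG
  have hsub : Gᶜ ⊆ {v | r ≤ |missingMass P A v - mR|}
      ∪ {v | Real.sqrt 2 * r ≤ |estimator A v - mE|} := by
    intro v hv
    by_contra hcon
    simp only [Set.mem_union, Set.mem_ofPred_eq, not_or, not_le, abs_lt] at hcon
    refine hv ⟨?_, ?_⟩ <;> linarith [hcon.1.1, hcon.1.2, hcon.2.1, hcon.2.2]
  have hcompl : ν.real Gᶜ ≤ δ :=
    (measureReal_mono hsub).trans ((measureReal_union_le _ _).trans (by linarith))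
  rw [probReal_compl_eq_one_sub (MeasurableSet.of_discrete)] at hcompl
  linarith

end GoodTuring

theorem proposition1
    {Ω : Type*} [Countable Ω] [MeasurableSpace Ω] [MeasurableSingletonClass Ω]
    (P : Measure Ω) [IsProbabilityMeasure P] (A : Set Ω)
    {S : Type*} [MeasurableSpace S] (μ : Measure S) [IsProbabilityMeasure μ]
    (n : ℕ) (hn : 1 ≤ n) (X : Fin n → S → Ω)
    (hlaw : ∀ m, HasLaw (X m) P μ) (hindep : iIndepFun X μ)
    (δ : ℝ) (hδ : 0 < δ) :
    1 - δ ≤ μ.real {s |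
      GoodTuring.estimator A (fun m => X m s) - 1 / (n : ℝ)
          - (1 + Real.sqrt 2) * Real.sqrt (Real.log (4 / δ) / (n : ℝ))
        ≤ GoodTuring.missingMass P A (fun m => X m s) ∧
      GoodTuring.missingMass P A (fun m => X m s)
        ≤ GoodTuring.estimator A (fun m => X m s)
          + (1 + Real.sqrt 2) * Real.sqrt (Real.log (4 / δ) / (n : ℝ))} := by
  rcases le_or_gt 1 δ with h1 | h1
  · exact (sub_nonpos.2 h1).trans measureReal_nonneg
  -- Independence makes the product measure the law of the whole sample, so the bound transfers from
  -- the canonical space.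
  have hX : HasLaw (fun s m => X m s) (Measure.pi fun _ : Fin n => P) μ :=
    (iIndepFun_iff_hasLaw_pi_pi hlaw).1 hindep
  have h := GoodTuring.le_measureReal_pi P A n hn δ hδ h1
  rw [← hX.map_eq, map_measureReal_apply_of_aemeasurable hX.aemeasurable
    (MeasurableSet.of_discrete)] at h
  exact h
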